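/- Let $\lambda_{\mathrm p}>0$, $m>0$, $\sigma>0$, $R\ge 0$, $r_{\mathsf K}\ge 0$ and put $r=R+r_{\mathsf K}$. Let $\Phi_{\mathrm p}=\{\mathbf x_0,\mathbf x_1,\dots\}$ be a homogeneous Poisson point process in $\mathbb R^2$ with intensity $\lambda_{\mathrm p}$, whose points are listed without repetition, and let $\Phi_{\mathrm d}^{(0)},\Phi_{\mathrm d}^{(1)},\dots$ be independent Poisson point processes in $\mathbb R^2$, jointly independent of the sequence $(\mathbf x_i)$, each with intensity function $$\lambda_{\mathrm d}(\mathbf y)=\frac{m}{2\pi\sigma^2}\exp\left(-\frac{\|\mathbf y\|^2}{2\sigma^2}\right).$$ Let $\Phi=\bigcup_i\,(\mathbf x_i+\Phi_{\mathrm d}^{(i)})$ be the resulting Thomas cluster process, and let $\Psi_{\mathrm T}=\bigcup_{\mathbf z\in\Phi}\,(\mathbf z+\mathcal B(\mathrm o,R))$ be the Boolean Thomas cluster model with sensing range $R$, where $\mathcal B(\mathrm o,s)$ is the closed disc of radius $s$ about the origin. Then the capacity functional of $\Psi_{\mathrm T}$ for the disc $\mathcal B(\mathrm o,r_{\mathsf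 K})$ is $$\mathbb P\big(\Psi_{\mathrm T}\cap\mathcal B(\mathrm o,r_{\mathsf K})\neq\emptyset\big)=1-\exp\left(-2\pi\lambda_{\mathrm p}\int_0^\infty\left(1-\exp\left(-\frac{m}{2\pi\sigma^2}\int_0^{2\pi}\int_0^r e^{-\frac{x^2+t^2+2xt\cos\theta}{2\sigma^2}}\,t\,dt\,d\theta\right)\right)x\,dx\right),$$ where the event on the left is measurable and the integral over $x$ converges. -/

import Mathlib

open MeasureTheory ProbabilityTheory Set
open scoped ENNReal NNReal Pointwise

noncomputable section

/-- The Euclidean plane. -/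
abbrev Plane : Type := EuclideanSpace ℝ (Fin 2)

/-- A locally finite configuration of points in the plane. -/
structure Configuration where
  /-- the set of points of the configuration -/
  points : Set Plane
  /-- every bounded region contains only finitely many points -/
  locallyFinite : ∀ B : Set Plane, Bornology.IsBounded B → (points ∩ B).Finite

namespace Configuration

/-- The number of points of a configuration in a region. -/
def count (A : Set Plane) (c : Configuration) : ℕ∞ := (c.points ∩ A).encard

/-- The usual σ-algebra on configurations: the smallest one for which the number of points in every
Borel set is a measurable function of the configuration. -/
instance : MeasurableSpace Configuration :=
  ⨆ (A : Set Plane) (_ : MeasurableSet A), MeasurableSpace.comap (count A) ⊤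

end Configuration

/-- The random configuration `Φ`, defined on the probability space `(Ω, P)`, is a Poisson point
process in the plane with intensity measure `Lam`: the number of points in each Borel set `A` of
finite intensity is Poisson distributed with mean `Lam A`, and the numbers of points in pairwise
disjoint Borel sets are independent. -/
structure IsPoissonPointProcess {Ω : Type*} [MeasurableSpace Ω] (P : Measure Ω)
    (Φ : Ω → Configuration) (Lam : Measure Plane) : Prop where
  measurable : Measurable Φ
  count_law : ∀ A : Set Plane, MeasurableSet A → Lam A ≠ ∞ →
    HasLaw (fun ω => (Φ ω).count A)
      ((poissonMeasure (Lam A).toNNReal).map (Nat.cast : ℕ → ℕ∞)) P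
  count_indep : ∀ (n : ℕ) (A : Fin n → Set Plane), (∀ k, MeasurableSet (A k)) →
    Pairwise (fun k l => Disjoint (A k) (A l)) →
    iIndepFun (fun k ω => (Φ ω).count (A k)) P

/-- The intensity measure of a homogeneous point process of intensity `lam`. -/
def homogeneousIntensity (lam : ℝ) : Measure Plane := ENNReal.ofReal lam • volume

/-- The intensity measure of a daughter process of the Thomas cluster process, with density
`m / (2 π σ²) * exp (- ‖y‖² / (2 σ²))`. -/
def thomasDaughterIntensity (m σ : ℝ) : Measure Plane :=
  volume.withDensity fun y =>
    ENNReal.ofReal (m / (2 * Real.pi * σ ^ 2) * Real.exp (-‖y‖ ^ 2 / (2 * σ ^ 2)))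

/-- The parents `Φp`, enumerated as `X 0, X 1, …`, and the daughter processes `D 0, D 1, …` (relative
to their parents) are the data of a Thomas cluster process with parent intensity `lamp`, mean number
of daughters `m` and daughter variance `σ ^ 2`. -/
structure IsThomasClusterData {Ω : Type*} [MeasurableSpace Ω] (P : Measure Ω)
    (Φp : Ω → Configuration) (X : ℕ → Ω → Plane) (D : ℕ → Ω → Configuration)
    (lamp m σ : ℝ) : Prop where
  parents_poisson : IsPoissonPointProcess P Φp (homogeneousIntensity lamp)
  enum_measurable : ∀ i, Measurable (X i)
  /-- almost surely, each parent is listed exactly once -/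
  enum_parents : ∀ᵐ ω ∂P, Function.Injective (fun i => X i ω) ∧
    range (fun i => X i ω) = (Φp ω).points
  daughters_poisson : ∀ i, IsPoissonPointProcess P (D i) (thomasDaughterIntensity m σ)
  daughters_indep : iIndepFun D P
  indep_parents : IndepFun (fun ω i => X i ω) (fun ω i => D i ω) P

/-- The cluster process: all points `X i + y` with `y` a point of the `i`-th daughter process. -/
def clusterProcess {Ω : Type*} (X : ℕ → Ω → Plane) (D : ℕ → Ω → Configuration) (ω : Ω) :
    Set Plane :=
  ⋃ i, X i ω +ᵥ (D i ω).points

/-- The Boolean model with germs `Φ` and the same deterministic grain `S` at every germ. -/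
def booleanModel {Ω : Type*} (Φ : Ω → Set Plane) (S : Set Plane) (ω : Ω) : Set Plane :=
  ⋃ z ∈ Φ ω, z +ᵥ S

/-- The event that the random set `Ψ` meets `K`. -/
def hittingEvent {Ω : Type*} (Ψ : Ω → Set Plane) (K : Set Plane) : Set Ω :=
  {ω | (Ψ ω ∩ K).Nonempty}

/-- The capacity functional of the random set `Ψ`: the probability that `Ψ` meets `K`. -/
def capacityFunctional {Ω : Type*} [MeasurableSpace Ω] (P : Measure Ω) (Ψ : Ω → Set Plane)
    (K : Set Plane) : ℝ :=
  P.real (hittingEvent Ψ K)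

/-- The Boolean Thomas cluster model with sensing range `R`. -/
def booleanThomas {Ω : Type*} (X : ℕ → Ω → Plane) (D : ℕ → Ω → Configuration) (R : ℝ) :
    Ω → Set Plane :=
  booleanModel (clusterProcess X D) (Metric.closedBall 0 R)

/-- The integrand `(1 - exp (-(m / 2πσ²) ∫₀^{2π} ∫₀^r e^{-(x² + t² + 2xt cos θ)/(2σ²)} t dt dθ)) x` of
the capacity functional of the Boolean Thomas cluster model. -/
def thomasIntegrand (m σ r x : ℝ) : ℝ :=
  (1 - Real.exp (-(m / (2 * Real.pi * σ ^ 2)) *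
    ∫ θ in (0 : ℝ)..(2 * Real.pi), ∫ t in (0 : ℝ)..r,
      Real.exp (-(x ^ 2 + t ^ 2 + 2 * x * t * Real.cos θ) / (2 * σ ^ 2)) * t)) * x

end

open Filter Topology

/-! Write `r = R + rK`. The disc of radius `rK` is missed exactly when, for every `i`, the daughter
process `D i` has no point in the closed disc of radius `r` about `-X i`. Given the parents these
events are independent, and the `i`-th has probability `exp (-g (X i))`, where `g x` is the daughter
intensity of the disc about `-x`. The avoidance probability is therefore `E exp (-∑ g (X i))`
(`measure_forall_notMem_of_indep`), and the Laplace functional of the parents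
(`IsPoissonPointProcess.lintegral_negExp_tsum`) turns it into `exp (-lamp * ∫ (1 - exp (-g x)) dx)`.

By rotation invariance `g` depends only on `‖x‖`, so polar coordinates, once for `g` and once for
the outer integral, give the stated formula. The outer integral converges because `1 - exp (-g) ≤ g`
and, by Fubini, `∫ g` is the area of the disc times the finite total daughter intensity.

Sums and exponents live in `[0, ∞]`, where `negExp` is continuous, so no convergence of `∑ g (X i)`
has to be shown. -/

/-- The function `s ↦ exp (-s)` on `[0, ∞]`, with value `0` at `∞`. -/
noncomputable def negExp (s : ℝ≥0∞) : ℝ≥0∞ := (EReal.exp (s : EReal))⁻¹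

lemma one_le_exp_coe_ennreal (s : ℝ≥0∞) : 1 ≤ EReal.exp (s : EReal) :=
  EReal.one_le_exp_iff.2 (EReal.coe_ennreal_nonneg s)

@[simp] lemma negExp_zero : negExp 0 = 1 := by simp [negExp]

lemma negExp_le_one (s : ℝ≥0∞) : negExp s ≤ 1 :=
  ENNReal.inv_le_one.2 (one_le_exp_coe_ennreal s)

lemma negExp_antitone : Antitone negExp := fun _ _ h =>
  ENNReal.inv_le_inv.2 (EReal.exp_monotone (EReal.coe_ennreal_le_coe_ennreal_iff.2 h))

lemma continuous_negExp : Continuous negExp :=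
  continuous_inv.comp (EReal.expHomeomorph.continuous.comp continuous_coe_ennreal_ereal)

lemma measurable_negExp : Measurable negExp := continuous_negExp.measurable

lemma negExp_add (s t : ℝ≥0∞) : negExp (s + t) = negExp s * negExp t := by
  have hs := (zero_lt_one.trans_le (one_le_exp_coe_ennreal s)).ne'
  have ht := (zero_lt_one.trans_le (one_le_exp_coe_ennreal t)).ne'
  rw [negExp, EReal.coe_ennreal_add, EReal.exp_add, ENNReal.mul_inv (.inl hs) (.inr ht)]
  rfl

lemma negExp_sum {ι : Type*} (s : Finset ι) (f : ι → ℝ≥0∞) :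
    negExp (∑ i ∈ s, f i) = ∏ i ∈ s, negExp (f i) := by
  classical
  induction s using Finset.induction_on with
  | empty => simp
  | insert a s ha ih => rw [Finset.sum_insert ha, Finset.prod_insert ha, negExp_add, ih]

lemma negExp_mul_natCast (s : ℝ≥0∞) (n : ℕ) : negExp (s * n) = negExp s ^ n := by
  induction n with
  | zero => simp
  | succ n ih => rw [Nat.cast_succ, mul_add, negExp_add, ih, pow_succ, mul_one]

lemma negExp_ofReal {x : ℝ} (hx : 0 ≤ x) : negExp (ENNReal.ofReal x) = ENNReal.ofReal (Real.exp (-x)) := by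
  rw [negExp, EReal.coe_ennreal_ofReal, max_eq_left hx, EReal.exp_coe, Real.exp_neg,
    ENNReal.ofReal_inv_of_pos (Real.exp_pos _)]

lemma one_sub_negExp_le (s : ℝ≥0∞) : 1 - negExp s ≤ s := by
  by_cases hs : s = ∞
  · simp [hs]
  · rw [← ENNReal.ofReal_toReal hs, negExp_ofReal ENNReal.toReal_nonneg, ← ENNReal.ofReal_one,
      ← ENNReal.ofReal_sub _ (Real.exp_nonneg _)]
    exact ENNReal.ofReal_le_ofReal (by linarith [Real.add_one_le_exp (-s.toReal)])

/-- The probability generating function of the Poisson law, from the exponential series at `r * q`.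
-/
lemma lintegral_poissonMeasure_pow (r : ℝ≥0) {q : ℝ≥0∞} (hq : q ≤ 1) :
    ∫⁻ n, q ^ n ∂(poissonMeasure r) = negExp (r * (1 - q)) := by
  obtain ⟨p, hp, rfl⟩ : ∃ p : ℝ, 0 ≤ p ∧ q = ENNReal.ofReal p :=
    ⟨q.toReal, ENNReal.toReal_nonneg,
      (ENNReal.ofReal_toReal (hq.trans_lt ENNReal.one_lt_top).ne).symm⟩
  have hp1 : p ≤ 1 := by simpa using hq
  have hs : HasSum (fun n : ℕ => Real.exp (-r) * r ^ n / (n.factorial : ℝ) * p ^ n)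
      (Real.exp (-(r * (1 - p)))) := by
    have := (NormedSpace.expSeries_div_hasSum_exp ((r : ℝ) * p)).mul_left (Real.exp (-r))
    rw [← Real.exp_eq_exp_ℝ, ← Real.exp_add] at this
    convert! this using 1
    · ext n; rw [mul_pow]; ring
    · congr 1; ring
  have hnn : ∀ n : ℕ, 0 ≤ Real.exp (-r) * r ^ n / (n.factorial : ℝ) := fun n => by positivity
  rw [poissonMeasure, lintegral_sum_measure]
  simp_rw [lintegral_smul_measure, lintegral_dirac, smul_eq_mul, ← ENNReal.ofReal_pow hp]
  simp_rw [← ENNReal.ofReal_mul (hnn _)]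
  rw [← ENNReal.ofReal_tsum_of_nonneg (fun n => mul_nonneg (hnn n) (pow_nonneg hp n)) hs.summable,
    hs.tsum_eq, ← ENNReal.ofReal_one, ← ENNReal.ofReal_sub _ hp,
    ← ENNReal.ofReal_coe_nnreal, ← ENNReal.ofReal_mul (NNReal.coe_nonneg r), negExp_ofReal]
  exact mul_nonneg (NNReal.coe_nonneg r) (by linarith)

/-! ### The Laplace functional of a Poisson process -/

section Laplace

variable {Ω : Type*} [MeasurableSpace Ω] {P : Measure Ω}

lemma Configuration.measurable_count {A : Set Plane} (hA : MeasurableSet A) :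
    Measurable (Configuration.count A) := by
  rw [measurable_iff_comap_le]
  exact le_iSup₂_of_le (f := fun (A : Set Plane) (_ : MeasurableSet A) =>
    MeasurableSpace.comap (Configuration.count A) ⊤) A hA le_rfl

/-- The generating function at `exp (-a)`. Infinite intensity is allowed when `a = 0`, since the
zero level set of a simple function is usually unbounded. -/
lemma IsPoissonPointProcess.lintegral_negExp_count [IsProbabilityMeasure P] {Φ : Ω → Configuration}
    {Lam : Measure Plane} (h : IsPoissonPointProcess P Φ Lam) {A : Set Plane}
    (hA : MeasurableSet A) {a : ℝ≥0∞} (hfin : a ≠ 0 → Lam A ≠ ∞) :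
    ∫⁻ ω, negExp (a * ((Φ ω).count A : ℕ∞)) ∂P = negExp ((1 - negExp a) * Lam A) := by
  by_cases ha : a = 0
  · simp [ha]
  · have hl := h.count_law A hA (hfin ha)
    rw [hl.lintegral_comp (f := fun n : ℕ∞ => negExp (a * (n : ℝ≥0∞)))
      (Measurable.of_discrete).aemeasurable, lintegral_map .of_discrete .of_discrete]
    simp only [ENat.toENNReal_coe, negExp_mul_natCast]
    rw [lintegral_poissonMeasure_pow _ (negExp_le_one a), ENNReal.coe_toNNReal (hfin ha), mul_comm]

lemma tsum_simpleFunc_eq_sum_encard {α : Type*} [MeasurableSpace α] (f : SimpleFunc α ℝ≥0∞) {x : ℕ → α}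
    (hx : Function.Injective x) :
    ∑' i, f (x i) = ∑ a ∈ f.range, a * ((range x ∩ f ⁻¹' {a}).encard : ℝ≥0∞) := by
  have h1 : ∀ i, f (x i) = ∑ a ∈ f.range, a * (x ⁻¹' (f ⁻¹' {a})).indicator (fun _ => 1) i := by
    intro i
    rw [Finset.sum_eq_single (f (x i))]
    · simp
    · intro b _ hb
      simp [indicator, hb.symm]
    · intro hn
      exact absurd (SimpleFunc.mem_range_self f (x i)) hn
  simp_rw [h1]
  rw [Summable.tsum_finsetSum fun _ _ => ENNReal.summable]
  refine Finset.sum_congr rfl fun a _ => ?_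
  rw [ENNReal.tsum_mul_left, ← tsum_subtype, ENNReal.tsum_set_one, inter_comm,
    ← image_preimage_eq_inter_range, hx.injOn.encard_image]

/-- The level sets of `f` are disjoint, so their counts are independent and the expectation
factorises over the values of `f`. -/
lemma IsPoissonPointProcess.lintegral_negExp_tsum_simpleFunc [IsProbabilityMeasure P]
    {Φ : Ω → Configuration} {Lam : Measure Plane} (h : IsPoissonPointProcess P Φ Lam)
    {X : ℕ → Ω → Plane}
    (hX : ∀ᵐ ω ∂P, Function.Injective (fun i => X i ω) ∧ range (fun i => X i ω) = (Φ ω).points)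
    (f : SimpleFunc Plane ℝ≥0∞) (hf : ∀ a, a ≠ 0 → Lam (f ⁻¹' {a}) ≠ ∞) :
    ∫⁻ ω, negExp (∑' i, f (X i ω)) ∂P = negExp (∫⁻ y, (1 - negExp (f y)) ∂Lam) := by
  have h1 : ∫⁻ ω, negExp (∑' i, f (X i ω)) ∂P =
      ∫⁻ ω, ∏ a : f.range, negExp (a * ((Φ ω).count (f ⁻¹' {(a : ℝ≥0∞)}) : ℕ∞)) ∂P := by
    refine lintegral_congr_ae ?_
    filter_upwards [hX] with ω hω
    rw [tsum_simpleFunc_eq_sum_encard f hω.1, hω.2, ← Finset.sum_coe_sort, negExp_sum]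
    rfl
  have hind : iIndepFun (fun (a : f.range) ω => (Φ ω).count (f ⁻¹' {(a : ℝ≥0∞)})) P := by
    have := (h.count_indep f.range.card (fun k => f ⁻¹' {((f.range.equivFin.symm k : f.range) : ℝ≥0∞)})
      (fun k => f.measurableSet_fiber _) fun k l hkl => ?_).precomp f.range.equivFin.injective
    · simpa using this
    · refine Disjoint.preimage f (disjoint_singleton.2 fun he => hkl ?_)
      exact f.range.equivFin.symm.injective (Subtype.ext he)
  have hind' := hind.comp (fun a n => negExp (a * (n : ℝ≥0∞))) fun a => Measurable.of_discrete
  have hc : ∀ a : f.range, Measurable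
      fun ω => negExp (a * (((Φ ω).count (f ⁻¹' {(a : ℝ≥0∞)}) : ℕ∞) : ℝ≥0∞)) := fun a =>
    (Measurable.of_discrete (f := fun n : ℕ∞ => negExp (a * (n : ℝ≥0∞)))).comp
      ((Configuration.measurable_count (f.measurableSet_fiber _)).comp h.measurable)
  rw [h1]
  refine (lintegral_prod_eq_prod_lintegral_of_indepFun Finset.univ _ hind' hc).trans ?_
  have h2 : ∫⁻ y, (1 - negExp (f y)) ∂Lam = ∫⁻ y, (f.map fun a => 1 - negExp a) y ∂Lam := rfl
  rw [h2, SimpleFunc.lintegral_eq_lintegral, SimpleFunc.map_lintegral, ← Finset.sum_coe_sort,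
    negExp_sum]
  exact Finset.prod_congr rfl fun a _ =>
    h.lintegral_negExp_count (f.measurableSet_fiber _) (hf a)

/-- The Laplace functional of a Poisson point process. -/
theorem IsPoissonPointProcess.lintegral_negExp_tsum [IsProbabilityMeasure P]
    {Φ : Ω → Configuration} {Lam : Measure Plane} (h : IsPoissonPointProcess P Φ Lam)
    [IsFiniteMeasureOnCompacts Lam] {X : ℕ → Ω → Plane} (hXm : ∀ i, Measurable (X i))
    (hX : ∀ᵐ ω ∂P, Function.Injective (fun i => X i ω) ∧ range (fun i => X i ω) = (Φ ω).points)
    {g : Plane → ℝ≥0∞} (hg : Measurable g) :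
    ∫⁻ ω, negExp (∑' i, g (X i ω)) ∂P = negExp (∫⁻ y, (1 - negExp (g y)) ∂Lam) := by
  -- Restriction to growing balls makes the nonzero level sets bounded, hence of finite intensity.
  let f : ℕ → SimpleFunc Plane ℝ≥0∞ := fun n =>
    (SimpleFunc.eapprox g n).restrict (Metric.closedBall 0 n)
  have hfc : ∀ n y, f n y =
      (Metric.closedBall (0 : Plane) n).indicator (SimpleFunc.eapprox g n) y := fun n y => by
    simp only [f]
    rw [SimpleFunc.restrict_apply _ Metric.isClosed_closedBall.measurableSet]
  have hmono : ∀ y, Monotone fun n => f n y := by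
    intro y m n hmn
    simp only [hfc]
    refine (indicator_le_indicator_of_subset
      (Metric.closedBall_subset_closedBall (Nat.cast_le.2 hmn)) (fun _ => zero_le) y).trans ?_
    exact indicator_le_indicator (SimpleFunc.monotone_eapprox g hmn y)
  have hlim : ∀ y, Tendsto (fun n => f n y) atTop (𝓝 (g y)) := by
    intro y
    refine (SimpleFunc.tendsto_eapprox hg y).congr' ?_
    obtain ⟨N, hN⟩ := exists_nat_ge ‖y‖
    filter_upwards [eventually_ge_atTop N] with n hn
    rw [hfc, indicator_of_mem]
    rw [mem_closedBall_zero_iff]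
    exact hN.trans (by exact_mod_cast hn)
  have hfin : ∀ n a, a ≠ 0 → Lam (f n ⁻¹' {a}) ≠ ∞ := by
    intro n a ha
    refine ne_top_of_le_ne_top (isCompact_closedBall (0 : Plane) n).measure_lt_top.ne
      (measure_mono fun y hy => ?_)
    by_contra hc
    rw [mem_preimage, hfc, indicator_of_notMem hc] at hy
    exact ha hy.symm
  have hL : Tendsto (fun n => ∫⁻ ω, negExp (∑' i, f n (X i ω)) ∂P) atTop
      (𝓝 (∫⁻ ω, negExp (∑' i, g (X i ω)) ∂P)) := by
    refine tendsto_lintegral_of_dominated_convergence (fun _ => 1) (fun n => ?_)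
      (fun n => .of_forall fun ω => negExp_le_one _) (by simp) (.of_forall fun ω => ?_)
    · exact measurable_negExp.comp
        (Measurable.tsum fun i => (f n).measurable.comp (hXm i))
    · refine (continuous_negExp.tendsto _).comp ?_
      -- The sum over points is an integral for counting measure, so monotone convergence applies.
      simp_rw [← lintegral_count]
      exact lintegral_tendsto_of_tendsto_of_monotone (fun n => Measurable.of_discrete.aemeasurable)
        (.of_forall fun i => hmono _) (.of_forall fun i => hlim _)
  have hR : Tendsto (fun n => negExp (∫⁻ y, (1 - negExp (f n y)) ∂Lam)) atTop
      (𝓝 (negExp (∫⁻ y, (1 - negExp (g y)) ∂Lam))) := by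
    refine (continuous_negExp.tendsto _).comp ?_
    refine lintegral_tendsto_of_tendsto_of_monotone
      (fun n => (measurable_const.sub (measurable_negExp.comp (f n).measurable)).aemeasurable)
      (.of_forall fun y m n hmn => tsub_le_tsub_left (negExp_antitone (hmono y hmn)) _)
      (.of_forall fun y => ?_)
    exact ENNReal.Tendsto.sub tendsto_const_nhds ((continuous_negExp.tendsto _).comp (hlim y))
      (.inl ENNReal.one_ne_top)
  refine tendsto_nhds_unique hL (hR.congr fun n => ?_)
  exact (h.lintegral_negExp_tsum_simpleFunc hX (f n) (hfin n)).symm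

end Laplace

/-! ### The hitting event and its measurability -/

lemma Configuration.count_ne_zero_iff {A : Set Plane} {c : Configuration} :
    c.count A ≠ 0 ↔ (c.points ∩ A).Nonempty := by
  rw [Configuration.count, Set.encard_ne_zero]

/-- Membership of a configuration in the family of those which hit a moving closed disc is
determined by its counts in countably many discs. -/
lemma Configuration.hits_closedBall_iff (c : Configuration) (x : Plane) (r : ℝ) :
    (c.points ∩ Metric.closedBall x r).Nonempty ↔
      ∀ n : ℕ, ∃ k : ℕ, dist x (TopologicalSpace.denseSeq Plane k) < 1 / ((n : ℝ) + 1) ∧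
        c.count (Metric.closedBall (TopologicalSpace.denseSeq Plane k) (r + 1 / ((n : ℝ) + 1))) ≠ 0 := by
  constructor
  · rintro ⟨y, hy, hyx⟩ n
    obtain ⟨k, hk⟩ := (TopologicalSpace.denseRange_denseSeq Plane).exists_dist_lt x
      (Nat.one_div_pos_of_nat (α := ℝ) (n := n))
    refine ⟨k, hk, Configuration.count_ne_zero_iff.2 ⟨y, hy, ?_⟩⟩
    rw [Metric.mem_closedBall] at hyx ⊢
    linarith [dist_triangle y x (TopologicalSpace.denseSeq Plane k)]
  · intro h
    have hz : ∀ n : ℕ, ∃ z ∈ c.points, dist z x ≤ r + 2 * (1 / ((n : ℝ) + 1)) := by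
      intro n
      obtain ⟨k, hk, hc⟩ := h n
      obtain ⟨z, hz, hzk⟩ := Configuration.count_ne_zero_iff.1 hc
      refine ⟨z, hz, ?_⟩
      rw [Metric.mem_closedBall] at hzk
      rw [dist_comm] at hk
      linarith [dist_triangle z (TopologicalSpace.denseSeq Plane k) x]
    choose z hz hzx using hz
    have hfin := c.locallyFinite (Metric.closedBall x (r + 2)) Metric.isBounded_closedBall
    have hmem : ∀ n, z n ∈ c.points ∩ Metric.closedBall x (r + 2) := fun n =>
      ⟨hz n, (hzx n).trans (by
        have : 1 / ((n : ℝ) + 1) ≤ 1 := by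
          rw [div_le_one (by positivity)]; linarith [Nat.cast_nonneg (α := ℝ) n]
        linarith)⟩
    by_contra hne
    rw [Set.not_nonempty_iff_eq_empty] at hne
    -- Local finiteness provides a point nearest to `x`. If it lay beyond distance `r`, the points
    -- `z n`, whose distances are at most `r + 2 / (n + 1)`, would eventually be nearer.
    obtain ⟨w, hw, hmin⟩ := hfin.exists_minimalFor (fun y => dist y x) _ ⟨z 0, hmem 0⟩
    have hlt : r < dist w x := by
      by_contra! hle
      exact (hne ▸ (⟨hw.1, hle⟩ : w ∈ c.points ∩ Metric.closedBall x r) : w ∈ (∅ : Set Plane))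
    obtain ⟨n, hn⟩ := exists_nat_one_div_lt (half_pos (sub_pos.2 hlt))
    have h1 : dist w x ≤ dist (z n) x := by
      rcases le_total (dist w x) (dist (z n) x) with h | h
      · exact h
      · exact hmin (hmem n) h
    linarith [hzx n]

/-- Joint measurability in centre and configuration is needed because the disc is centred at a
random point. -/
lemma Configuration.measurableSet_hits_closedBall (r : ℝ) :
    MeasurableSet {p : Plane × Configuration | (p.2.points ∩ Metric.closedBall p.1 r).Nonempty} := by
  simp_rw [Configuration.hits_closedBall_iff, ofPred_forall, ofPred_exists, ofPred_and]
  refine .iInter fun n => .iUnion fun k => .inter ?_ ?_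
  · exact measurableSet_lt (measurable_fst.dist measurable_const) measurable_const
  · exact ((Configuration.measurable_count Metric.isClosed_closedBall.measurableSet).comp
      measurable_snd) (MeasurableSet.of_discrete (s := {0}ᶜ))

lemma mem_hittingEvent_booleanThomas {Ω : Type*} {X : ℕ → Ω → Plane} {D : ℕ → Ω → Configuration}
    {R rK : ℝ} (hR : 0 ≤ R) (hrK : 0 ≤ rK) {ω : Ω} :
    ω ∈ hittingEvent (booleanThomas X D R) (Metric.closedBall 0 rK) ↔
      ∃ i, ((D i ω).points ∩ Metric.closedBall (-X i ω) (R + rK)).Nonempty := by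
  have key : ∀ z : Plane,
      (∃ b, ‖b‖ ≤ R ∧ ‖z + b‖ ≤ rK) ↔ ‖z‖ ≤ R + rK := by
    intro z
    constructor
    · rintro ⟨b, hb, hzb⟩
      calc ‖z‖ = ‖(z + b) - b‖ := by simp
        _ ≤ ‖z + b‖ + ‖b‖ := norm_sub_le _ _
        _ ≤ R + rK := by linarith
    · intro hz
      -- The Minkowski sum of discs of radii `R` and `rK` is the disc of radius `R + rK`.
      have : z ∈ Metric.closedBall (0 : Plane) R + Metric.closedBall (0 : Plane) rK := by
        rw [closedBall_add_closedBall hR hrK]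
        simpa using hz
      obtain ⟨a, ha, b, hb, rfl⟩ := this
      refine ⟨-a, by simpa using ha, by simpa using hb⟩
  simp only [hittingEvent, booleanThomas, booleanModel, clusterProcess, mem_ofPred_eq,
    Set.Nonempty, mem_inter_iff, mem_iUnion, mem_vadd_set, mem_closedBall_zero_iff, vadd_eq_add]
  constructor
  · rintro ⟨_, ⟨_, ⟨i, y, hy, rfl⟩, b, hb, rfl⟩, hv⟩
    refine ⟨i, y, hy, ?_⟩
    rw [mem_closedBall_iff_norm, sub_neg_eq_add, add_comm]
    exact (key _).1 ⟨b, hb, hv⟩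
  · rintro ⟨i, y, hy, hyX⟩
    rw [mem_closedBall_iff_norm, sub_neg_eq_add, add_comm] at hyX
    obtain ⟨b, hb, hv⟩ := (key _).2 hyX
    exact ⟨_, ⟨_, ⟨i, y, hy, rfl⟩, b, hb, rfl⟩, hv⟩

/-! ### Conditioning on the parents -/

section Conditioning

variable {Ω : Type*} [MeasurableSpace Ω] {P : Measure Ω}

lemma measurableSet_hittingEvent_booleanThomas {X : ℕ → Ω → Plane} {D : ℕ → Ω → Configuration}
    {R rK : ℝ} (hR : 0 ≤ R) (hrK : 0 ≤ rK) (hX : ∀ i, Measurable (X i))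
    (hD : ∀ i, Measurable (D i)) :
    MeasurableSet (hittingEvent (booleanThomas X D R) (Metric.closedBall 0 rK)) := by
  have : hittingEvent (booleanThomas X D R) (Metric.closedBall 0 rK) =
      ⋃ i, (fun ω => (-X i ω, D i ω)) ⁻¹'
        {p : Plane × Configuration | (p.2.points ∩ Metric.closedBall p.1 (R + rK)).Nonempty} := by
    ext ω
    simp [mem_hittingEvent_booleanThomas hR hrK]
  rw [this]
  exact .iUnion fun i => ((hX i).neg.prodMk (hD i))
    (Configuration.measurableSet_hits_closedBall _)

lemma IsPoissonPointProcess.measure_disjoint [IsProbabilityMeasure P] {Φ : Ω → Configuration}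
    {Lam : Measure Plane} (h : IsPoissonPointProcess P Φ Lam) {A : Set Plane}
    (hA : MeasurableSet A) (hfin : Lam A ≠ ∞) :
    P {ω | ¬ ((Φ ω).points ∩ A).Nonempty} = negExp (Lam A) := by
  have h1 := (h.count_law A hA hfin).measure_eq (p := fun n => n = 0) .of_discrete
  have h2 : {ω | ¬ ((Φ ω).points ∩ A).Nonempty} = {ω | (Φ ω).count A = 0} := by
    ext ω
    simp only [mem_ofPred_eq, ← Configuration.count_ne_zero_iff, not_not]
  have h3 : (Nat.cast : ℕ → ℕ∞) ⁻¹' {n | n = 0} = {0} := by ext; simp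
  rw [h2, h1, Measure.map_apply .of_discrete .of_discrete, h3, poissonMeasure_singleton]
  conv_rhs => rw [← ENNReal.ofReal_toReal hfin, negExp_ofReal ENNReal.toReal_nonneg]
  simp [ENNReal.coe_toNNReal_eq_toReal]

/-- If marks `D i` are independent of each other and of the points `X i`, the probability that no
pair `(X i, D i)` lies in `M` is the mean of the product of the conditional probabilities. -/
lemma measure_forall_notMem_of_indep {E F : Type*} [MeasurableSpace E] [MeasurableSpace F]
    [IsProbabilityMeasure P] {X : ℕ → Ω → E} {D : ℕ → Ω → F} (hX : ∀ i, Measurable (X i))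
    (hD : ∀ i, Measurable (D i)) (hDi : iIndepFun D P)
    (hXD : IndepFun (fun ω i => X i ω) (fun ω i => D i ω) P) {M : Set (E × F)}
    (hM : MeasurableSet M) {g : E → ℝ≥0∞} (hg : Measurable g)
    (hgM : ∀ i x, P {ω | (x, D i ω) ∉ M} = negExp (g x)) :
    P {ω | ∀ i, (X i ω, D i ω) ∉ M} = ∫⁻ ω, negExp (∑' i, g (X i ω)) ∂P := by
  have hXm : Measurable fun ω i => X i ω := measurable_pi_lambda _ hX
  have hDm : Measurable fun ω i => D i ω := measurable_pi_lambda _ hD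
  -- For finitely many indices, independence makes the joint law a product: freeze the `X i` and
  -- factorise over the `D i`. Then let `n` tend to infinity.
  have hfinite : ∀ n : ℕ, P {ω | ∀ i ∈ Finset.range n, (X i ω, D i ω) ∉ M} =
      ∫⁻ ω, negExp (∑ i ∈ Finset.range n, g (X i ω)) ∂P := by
    intro n
    let S : Set ((ℕ → E) × (ℕ → F)) := {p | ∀ i ∈ Finset.range n, (p.1 i, p.2 i) ∉ M}
    have hS : MeasurableSet S := by
      simp only [S, ofPred_forall]
      refine .iInter fun i => .iInter fun _ => ?_
      have hi : Measurable fun p : (ℕ → E) × (ℕ → F) => (p.1 i, p.2 i) := by fun_prop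
      exact hi hM.compl
    have h1 : P {ω | ∀ i ∈ Finset.range n, (X i ω, D i ω) ∉ M} =
        P.map (fun ω => ((fun i => X i ω), fun i => D i ω)) S := by
      rw [Measure.map_apply (hXm.prodMk hDm) hS]; rfl
    rw [h1, (indepFun_iff_map_prod_eq_prod_map_map hXm.aemeasurable hDm.aemeasurable).1 hXD,
      Measure.prod_apply hS, lintegral_map (measurable_measure_prodMk_left hS) hXm]
    refine lintegral_congr fun ω => ?_
    rw [Measure.map_apply hDm (measurable_prodMk_left hS), negExp_sum]
    have h2 := hDi.measure_inter_preimage_eq_mul (Finset.range n)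
      (sets := fun i => {d | (X i ω, d) ∉ M}) fun i _ => measurable_prodMk_left hM.compl
    have h3 : (fun ω i => D i ω) ⁻¹' (Prod.mk (fun i => X i ω) ⁻¹' S) =
        ⋂ i ∈ Finset.range n, D i ⁻¹' {d | (X i ω, d) ∉ M} := by
      ext ω'
      simp [S]
    rw [h3, h2]
    exact Finset.prod_congr rfl fun i _ => hgM i _
  have hL : Tendsto (fun n => P {ω | ∀ i ∈ Finset.range n, (X i ω, D i ω) ∉ M}) atTop
      (𝓝 (P {ω | ∀ i, (X i ω, D i ω) ∉ M})) := by
    have h4 : {ω | ∀ i, (X i ω, D i ω) ∉ M} =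
        ⋂ n : ℕ, {ω | ∀ i ∈ Finset.range n, (X i ω, D i ω) ∉ M} := by
      ext ω
      simp only [mem_ofPred_eq, mem_iInter, Finset.mem_range]
      exact ⟨fun h _ i _ => h i, fun h i => h (i + 1) i i.lt_succ_self⟩
    rw [h4]
    refine tendsto_measure_iInter_atTop (fun n => MeasurableSet.nullMeasurableSet ?_) ?_
      ⟨0, measure_ne_top _ _⟩
    · simp only [ofPred_forall]
      exact .iInter fun i => .iInter fun _ => ((hX i).prodMk (hD i)) hM.compl
    · exact fun m n hmn ω hω i hi => hω i (Finset.range_mono hmn hi)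
  refine tendsto_nhds_unique hL ?_
  simp_rw [hfinite]
  refine tendsto_lintegral_of_dominated_convergence (fun _ => 1) (fun n => ?_)
    (fun n => .of_forall fun ω => negExp_le_one _) (by simp) (.of_forall fun ω => ?_)
  · exact measurable_negExp.comp (Finset.measurable_fun_sum _ fun i _ => hg.comp (hX i))
  · exact (continuous_negExp.tendsto _).comp ENNReal.summable.hasSum.tendsto_sum_nat

end Conditioning

/-! ### Gaussian integrals over discs -/

/-- The integral of `e^{-(x² + t² + 2xt cos θ)/(2σ²)}` over the disc of radius `r`, in polar
coordinates `(t, θ)`. -/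
noncomputable def gaussianDiscIntegral (σ r x : ℝ) : ℝ :=
  ∫ θ in (0 : ℝ)..(2 * Real.pi), ∫ t in (0 : ℝ)..r,
    Real.exp (-(x ^ 2 + t ^ 2 + 2 * x * t * Real.cos θ) / (2 * σ ^ 2)) * t

lemma gaussianDiscIntegral_nonneg {r : ℝ} (hr : 0 ≤ r) (σ x : ℝ) :
    0 ≤ gaussianDiscIntegral σ r x :=
  intervalIntegral.integral_nonneg Real.two_pi_pos.le fun _ _ =>
    intervalIntegral.integral_nonneg hr fun _ ht => mul_nonneg (Real.exp_nonneg _) ht.1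

lemma integral_closedBall_zero_complex {r : ℝ} (hr : 0 ≤ r) {f : ℂ → ℝ} (hf : Continuous f) :
    ∫ z in Metric.closedBall (0 : ℂ) r, f z =
      ∫ θ in (-Real.pi)..Real.pi, ∫ t in (0 : ℝ)..r, t * f (Complex.polarCoord.symm (t, θ)) := by
  have hcont : Continuous fun p : ℝ × ℝ => p.1 * f (Complex.polarCoord.symm p) := by
    simp only [Complex.polarCoord_symm_apply]
    fun_prop
  have hsub : Ioc (0 : ℝ) r ×ˢ Ioo (-Real.pi) Real.pi ⊆ polarCoord.target := fun p hp =>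
    ⟨hp.1.1, hp.2⟩
  rw [← integral_indicator Metric.isClosed_closedBall.measurableSet,
    ← Complex.integral_comp_polarCoord_symm]
  have h1 : ∫ p in polarCoord.target, p.1 • (Metric.closedBall (0 : ℂ) r).indicator f
      (Complex.polarCoord.symm p) = ∫ p in polarCoord.target,
        (Ioc (0 : ℝ) r ×ˢ Ioo (-Real.pi) Real.pi).indicator
          (fun p => p.1 * f (Complex.polarCoord.symm p)) p := by
    refine setIntegral_congr_fun (measurableSet_Ioi.prod measurableSet_Ioo) fun p hp => ?_
    have hp1 : 0 < p.1 := hp.1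
    by_cases hpr : p.1 ≤ r
    · rw [indicator_of_mem (a := p) (show p ∈ Ioc (0 : ℝ) r ×ˢ Ioo (-Real.pi) Real.pi from ⟨⟨hp1, hpr⟩, hp.2⟩)]
      simp only [smul_eq_mul]
      rw [indicator_of_mem]
      simpa [-Complex.polarCoord_symm_apply, Complex.norm_polarCoord_symm, abs_of_pos hp1] using hpr
    · rw [indicator_of_notMem (a := p) (fun h => hpr h.1.2)]
      simp only [smul_eq_mul]
      rw [indicator_of_notMem, mul_zero]
      simpa [-Complex.polarCoord_symm_apply, Complex.norm_polarCoord_symm, abs_of_pos hp1] using hpr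
  have hms : MeasurableSet (Ioc (0 : ℝ) r ×ˢ Ioo (-Real.pi) Real.pi) :=
    measurableSet_Ioc.prod measurableSet_Ioo
  rw [h1, setIntegral_indicator hms, inter_eq_self_of_subset_right hsub,
    intervalIntegral.integral_of_le (by linarith [Real.pi_pos]), integral_Ioc_eq_integral_Ioo,
    Measure.volume_eq_prod, ← Measure.prod_restrict, integral_prod_symm]
  · simp_rw [intervalIntegral.integral_of_le hr]
  · rw [Measure.prod_restrict]
    exact (hcont.continuousOn.integrableOn_compact (isCompact_Icc.prod isCompact_Icc)).mono_set
      (prod_mono Ioc_subset_Icc_self Ioo_subset_Icc_self)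

/-- The law of cosines. Shifting the angle by `π` turns its minus sign into the plus sign of the
integrand. -/
lemma norm_polarCoord_symm_sub_sq (t θ ρ φ : ℝ) :
    ‖Complex.polarCoord.symm (t, θ) - ρ * (Real.cos φ + Real.sin φ * Complex.I)‖ ^ 2 =
      ρ ^ 2 + t ^ 2 + 2 * ρ * t * Real.cos (θ + (Real.pi - φ)) := by
  have : θ + (Real.pi - φ) = (θ - φ) + Real.pi := by ring
  rw [← Complex.normSq_eq_norm_sq, Complex.normSq_apply, this, Real.cos_add_pi, Real.cos_sub]
  simp [-Complex.ofReal_cos, -Complex.ofReal_sin]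
  linear_combination t ^ 2 * Real.sin_sq_add_cos_sq θ + ρ ^ 2 * Real.sin_sq_add_cos_sq φ

lemma integral_closedBall_gaussian {r : ℝ} (hr : 0 ≤ r) (σ : ℝ) (w : ℂ) :
    ∫ z in Metric.closedBall (0 : ℂ) r, Real.exp (-‖z - w‖ ^ 2 / (2 * σ ^ 2)) =
      gaussianDiscIntegral σ r ‖w‖ := by
  rw [integral_closedBall_zero_complex hr (by fun_prop)]
  have hw : w = ‖w‖ * (Real.cos w.arg + Real.sin w.arg * Complex.I) := by
    simp
  let F : ℝ → ℝ := fun θ => ∫ t in (0 : ℝ)..r,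
    Real.exp (-(‖w‖ ^ 2 + t ^ 2 + 2 * ‖w‖ * t * Real.cos θ) / (2 * σ ^ 2)) * t
  -- Periodicity absorbs the shift by `π - arg w` and moves the range from `[-π, π]` to `[0, 2π]`.
  have hF : Function.Periodic F (2 * Real.pi) := fun θ => by simp [F]
  have h1 : ∀ θ t : ℝ, ‖Complex.polarCoord.symm (t, θ) - w‖ ^ 2 =
      ‖w‖ ^ 2 + t ^ 2 + 2 * ‖w‖ * t * Real.cos (θ + (Real.pi - w.arg)) := fun θ t => by
    conv_lhs => rw [hw]
    exact norm_polarCoord_symm_sub_sq t θ ‖w‖ w.arg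
  simp_rw [h1, mul_comm _ (Real.exp _)]
  have h2 := intervalIntegral.integral_comp_add_right (a := -Real.pi) (b := Real.pi) F
    (Real.pi - w.arg)
  refine h2.trans ?_
  have h3 := hF.intervalIntegral_add_eq (-Real.pi + (Real.pi - w.arg)) 0
  rw [show -Real.pi + (Real.pi - w.arg) + 2 * Real.pi = Real.pi + (Real.pi - w.arg) by ring,
    zero_add] at h3
  exact h3

lemma setIntegral_closedBall_gaussian_plane {r : ℝ} (hr : 0 ≤ r) (σ : ℝ) (x : Plane) :
    ∫ y in Metric.closedBall (-x) r, Real.exp (-‖y‖ ^ 2 / (2 * σ ^ 2)) =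
      gaussianDiscIntegral σ r ‖x‖ := by
  let e : Plane ≃ₗᵢ[ℝ] ℂ := Complex.orthonormalBasisOneI.repr.symm
  have h1 : (fun y : Plane => (Metric.closedBall (-x) r).indicator
      (fun y => Real.exp (-‖y‖ ^ 2 / (2 * σ ^ 2))) (y - x)) = fun y =>
      (Metric.closedBall (0 : ℂ) r).indicator
        (fun z => Real.exp (-‖z - e x‖ ^ 2 / (2 * σ ^ 2))) (e y) := by
    ext y
    simp only [indicator, mem_closedBall_iff_norm, sub_neg_eq_add, sub_add_cancel, sub_zero,
      ← map_sub, LinearIsometryEquiv.norm_map]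
  rw [← integral_indicator Metric.isClosed_closedBall.measurableSet,
    ← integral_sub_right_eq_self _ x, h1,
    e.measurePreserving.integral_comp e.toHomeomorph.measurableEmbedding
      (g := (Metric.closedBall (0 : ℂ) r).indicator
        (fun z => Real.exp (-‖z - e x‖ ^ 2 / (2 * σ ^ 2)))),
    integral_indicator Metric.isClosed_closedBall.measurableSet,
    integral_closedBall_gaussian hr, LinearIsometryEquiv.norm_map]

lemma integrable_gaussian_plane {σ : ℝ} (hσ : 0 < σ) :
    Integrable fun y : Plane => Real.exp (-‖y‖ ^ 2 / (2 * σ ^ 2)) := by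
  have hb : 0 < 1 / (2 * σ ^ 2) := by positivity
  have h := GaussianFourier.integral_rexp_neg_mul_sq_norm (V := Plane) hb
  have : (fun y : Plane => Real.exp (-‖y‖ ^ 2 / (2 * σ ^ 2))) =
      fun y : Plane => Real.exp (-(1 / (2 * σ ^ 2)) * ‖y‖ ^ 2) := by
    ext y; congr 1; ring
  rw [this]
  -- A non-integrable function has Bochner integral `0`, so the nonzero closed form proves
  -- integrability.
  refine Integrable.of_integral_ne_zero ?_
  rw [h]
  positivity

/-! ### Intensity of discs and the outer integral -/

section Intensity

variable {m σ r : ℝ}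

lemma integrable_thomasDensity (m : ℝ) (hσ : 0 < σ) : Integrable fun y : Plane =>
    m / (2 * Real.pi * σ ^ 2) * Real.exp (-‖y‖ ^ 2 / (2 * σ ^ 2)) :=
  (integrable_gaussian_plane hσ).const_mul _

lemma isFiniteMeasure_thomasDaughterIntensity (m : ℝ) (hσ : 0 < σ) :
    IsFiniteMeasure (thomasDaughterIntensity m σ) :=
  isFiniteMeasure_withDensity_ofReal (integrable_thomasDensity m hσ).2

lemma thomasDaughterIntensity_closedBall (hm : 0 < m) (hσ : 0 < σ) (hr : 0 ≤ r) (x : Plane) :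
    thomasDaughterIntensity m σ (Metric.closedBall (-x) r) =
      ENNReal.ofReal (m / (2 * Real.pi * σ ^ 2) * gaussianDiscIntegral σ r ‖x‖) := by
  rw [thomasDaughterIntensity, withDensity_apply _ Metric.isClosed_closedBall.measurableSet,
    ← ofReal_integral_eq_lintegral_ofReal (integrable_thomasDensity m hσ).integrableOn
      (.of_forall fun y => by positivity), integral_const_mul,
    setIntegral_closedBall_gaussian_plane hr]

lemma measurableSet_closedBall_neg (r : ℝ) :
    MeasurableSet {p : Plane × Plane | p.2 ∈ Metric.closedBall (-p.1) r} :=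
  measurableSet_le (measurable_snd.dist measurable_fst.neg) measurable_const

lemma measurable_measure_closedBall_neg (Lam : Measure Plane) [IsFiniteMeasure Lam] (r : ℝ) :
    Measurable fun x : Plane => Lam (Metric.closedBall (-x) r) :=
  measurable_measure_prodMk_left (measurableSet_closedBall_neg r)

/-- Fubini, with the symmetry that `y` lies in the disc about `-x` exactly when `x` lies in the disc
about `-y`. -/
lemma lintegral_measure_closedBall_neg (Lam : Measure Plane) [IsFiniteMeasure Lam] (r : ℝ) :
    ∫⁻ x : Plane, Lam (Metric.closedBall (-x) r) =
      volume (Metric.closedBall (0 : Plane) r) * Lam univ := by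
  have h := (Measure.prod_apply (μ := (volume : Measure Plane)) (ν := Lam)
    (measurableSet_closedBall_neg r)).symm.trans
    (Measure.prod_apply_symm (measurableSet_closedBall_neg r))
  refine h.trans ?_
  rw [← lintegral_const]
  refine lintegral_congr fun y => ?_
  have : (fun x : Plane => (x, y)) ⁻¹' {p : Plane × Plane | p.2 ∈ Metric.closedBall (-p.1) r} =
      Metric.closedBall (-y) r := by
    ext x
    simp only [mem_preimage, mem_ofPred_eq, mem_closedBall_iff_norm, sub_neg_eq_add, add_comm]
  rw [this, Measure.addHaar_closedBall_center]

lemma one_sub_negExp_thomasDaughterIntensity (hm : 0 < m) (hσ : 0 < σ) (hr : 0 ≤ r) (x : Plane) :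
    1 - negExp (thomasDaughterIntensity m σ (Metric.closedBall (-x) r)) = ENNReal.ofReal
      (1 - Real.exp (-(m / (2 * Real.pi * σ ^ 2)) * gaussianDiscIntegral σ r ‖x‖)) := by
  rw [thomasDaughterIntensity_closedBall hm hσ hr, negExp_ofReal
    (mul_nonneg (by positivity) (gaussianDiscIntegral_nonneg hr _ _)),
    ENNReal.ofReal_sub _ (Real.exp_nonneg _), ENNReal.ofReal_one, neg_mul]

lemma one_sub_exp_gaussianDiscIntegral_nonneg (hm : 0 < m) (hr : 0 ≤ r) (x : ℝ) :
    0 ≤ 1 - Real.exp (-(m / (2 * Real.pi * σ ^ 2)) * gaussianDiscIntegral σ r x) := by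
  have h := gaussianDiscIntegral_nonneg hr σ x
  rw [sub_nonneg, Real.exp_le_one_iff, neg_mul, neg_nonpos]
  positivity

lemma integrable_one_sub_exp_gaussianDiscIntegral (hm : 0 < m) (hσ : 0 < σ) (hr : 0 ≤ r) :
    Integrable fun x : Plane =>
      1 - Real.exp (-(m / (2 * Real.pi * σ ^ 2)) * gaussianDiscIntegral σ r ‖x‖) := by
  have := isFiniteMeasure_thomasDaughterIntensity m hσ
  have h1 : (fun x : Plane =>
      1 - Real.exp (-(m / (2 * Real.pi * σ ^ 2)) * gaussianDiscIntegral σ r ‖x‖)) = fun x =>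
      (1 - negExp (thomasDaughterIntensity m σ (Metric.closedBall (-x) r))).toReal := by
    ext x
    rw [one_sub_negExp_thomasDaughterIntensity hm hσ hr,
      ENNReal.toReal_ofReal (one_sub_exp_gaussianDiscIntegral_nonneg hm hr _)]
  rw [h1]
  refine integrable_toReal_of_lintegral_ne_top
    (measurable_const.sub (measurable_negExp.comp
      (measurable_measure_closedBall_neg _ r))).aemeasurable ?_
  refine ne_top_of_le_ne_top ?_ (lintegral_mono fun x => one_sub_negExp_le _)
  rw [lintegral_measure_closedBall_neg]
  exact ENNReal.mul_ne_top (isCompact_closedBall _ _).measure_lt_top.ne (measure_ne_top _ _)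

lemma integrableOn_thomasIntegrand (hm : 0 < m) (hσ : 0 < σ) (hr : 0 ≤ r) :
    IntegrableOn (thomasIntegrand m σ r) (Ioi 0) := by
  have h := (integrable_fun_norm_addHaar (E := Plane) volume (f := fun x =>
      1 - Real.exp (-(m / (2 * Real.pi * σ ^ 2)) * gaussianDiscIntegral σ r x))).1
    (integrable_one_sub_exp_gaussianDiscIntegral hm hσ hr)
  refine h.congr_fun (fun x _ => ?_) measurableSet_Ioi
  simp [thomasIntegrand, gaussianDiscIntegral, mul_comm]

lemma integral_one_sub_exp_gaussianDiscIntegral (m σ r : ℝ) :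
    ∫ x : Plane, (1 - Real.exp (-(m / (2 * Real.pi * σ ^ 2)) * gaussianDiscIntegral σ r ‖x‖)) =
      2 * Real.pi * ∫ x in Ioi (0 : ℝ), thomasIntegrand m σ r x := by
  have h := integral_fun_norm_addHaar (E := Plane) volume fun x =>
    1 - Real.exp (-(m / (2 * Real.pi * σ ^ 2)) * gaussianDiscIntegral σ r x)
  -- The factor `2π` is the dimension `2` times the area `π` of the unit disc.
  rw [h, measureReal_def, EuclideanSpace.volume_ball_fin_two]
  have h2 : ∫ y in Ioi (0 : ℝ), y ^ (Module.finrank ℝ Plane - 1) •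
      (1 - Real.exp (-(m / (2 * Real.pi * σ ^ 2)) * gaussianDiscIntegral σ r y)) =
      ∫ x in Ioi (0 : ℝ), thomasIntegrand m σ r x := by
    congr 1 with x
    simp [thomasIntegrand, gaussianDiscIntegral, mul_comm]
  rw [h2]
  simp [Real.pi_nonneg]
  ring

lemma lintegral_one_sub_negExp_homogeneousIntensity {lamp : ℝ} (hlamp : 0 < lamp) (hm : 0 < m)
    (hσ : 0 < σ) (hr : 0 ≤ r) :
    ∫⁻ x, (1 - negExp (thomasDaughterIntensity m σ (Metric.closedBall (-x) r)))
      ∂(homogeneousIntensity lamp) = ENNReal.ofReal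
        (2 * Real.pi * lamp * ∫ x in Ioi (0 : ℝ), thomasIntegrand m σ r x) := by
  simp_rw [one_sub_negExp_thomasDaughterIntensity hm hσ hr]
  rw [homogeneousIntensity, lintegral_smul_measure, ← ofReal_integral_eq_lintegral_ofReal
    (integrable_one_sub_exp_gaussianDiscIntegral hm hσ hr)
    (.of_forall fun x => one_sub_exp_gaussianDiscIntegral_nonneg hm hr _),
    integral_one_sub_exp_gaussianDiscIntegral, smul_eq_mul, ← ENNReal.ofReal_mul hlamp.le]
  congr 1
  ring

end Intensity


theorem theorem5 {Ω : Type*} [MeasurableSpace Ω] (P : Measure Ω) [IsProbabilityMeasure P]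
    (lamp m σ R rK : ℝ) (hlamp : 0 < lamp) (hm : 0 < m) (hσ : 0 < σ) (hR : 0 ≤ R) (hrK : 0 ≤ rK)
    (Φp : Ω → Configuration) (X : ℕ → Ω → Plane) (D : ℕ → Ω → Configuration)
    (hT : IsThomasClusterData P Φp X D lamp m σ) :
    MeasurableSet (hittingEvent (booleanThomas X D R) (Metric.closedBall 0 rK)) ∧
    IntegrableOn (thomasIntegrand m σ (R + rK)) (Ioi 0) ∧
    capacityFunctional P (booleanThomas X D R) (Metric.closedBall 0 rK) =
      1 - Real.exp (-(2 * Real.pi * lamp * ∫ x in Ioi (0 : ℝ), thomasIntegrand m σ (R + rK) x)) := by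
  have hr : 0 ≤ R + rK := add_nonneg hR hrK
  have hD : ∀ i, Measurable (D i) := fun i => (hT.daughters_poisson i).measurable
  have hmeas := measurableSet_hittingEvent_booleanThomas hR hrK hT.enum_measurable hD
  refine ⟨hmeas, integrableOn_thomasIntegrand hm hσ hr, ?_⟩
  have := isFiniteMeasure_thomasDaughterIntensity m hσ
  have : IsFiniteMeasureOnCompacts (homogeneousIntensity lamp) :=
    inferInstanceAs (IsFiniteMeasureOnCompacts ((Real.toNNReal lamp) • (volume : Measure Plane)))
  have hg := measurable_measure_closedBall_neg (thomasDaughterIntensity m σ) (R + rK)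
  let M : Set (Plane × Configuration) :=
    {p | (p.2.points ∩ Metric.closedBall (-p.1) (R + rK)).Nonempty}
  have hM : MeasurableSet M :=
    (measurable_fst.neg.prodMk measurable_snd) (Configuration.measurableSet_hits_closedBall (R + rK))
  have hgM : ∀ i x, P {ω | (x, D i ω) ∉ M} =
      negExp (thomasDaughterIntensity m σ (Metric.closedBall (-x) (R + rK))) := by
    intro i x
    rw [← (hT.daughters_poisson i).measure_disjoint Metric.isClosed_closedBall.measurableSet
      (measure_ne_top _ _)]
    rfl
  have hcompl : (hittingEvent (booleanThomas X D R) (Metric.closedBall 0 rK))ᶜ =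
      {ω | ∀ i, (X i ω, D i ω) ∉ M} := by
    ext ω
    rw [mem_compl_iff, mem_hittingEvent_booleanThomas hR hrK, not_exists]
    rfl
  have hI : 0 ≤ ∫ x in Ioi (0 : ℝ), thomasIntegrand m σ (R + rK) x :=
    setIntegral_nonneg measurableSet_Ioi fun x hx =>
      mul_nonneg (one_sub_exp_gaussianDiscIntegral_nonneg hm hr x) (le_of_lt hx)
  have hP : P (hittingEvent (booleanThomas X D R) (Metric.closedBall 0 rK))ᶜ = ENNReal.ofReal
      (Real.exp (-(2 * Real.pi * lamp *
        ∫ x in Ioi (0 : ℝ), thomasIntegrand m σ (R + rK) x))) := by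
    rw [hcompl, measure_forall_notMem_of_indep hT.enum_measurable hD hT.daughters_indep
      hT.indep_parents hM hg hgM,
      hT.parents_poisson.lintegral_negExp_tsum hT.enum_measurable hT.enum_parents hg,
      lintegral_one_sub_negExp_homogeneousIntensity hlamp hm hσ hr, negExp_ofReal (by positivity)]
  have h1 := probReal_compl_eq_one_sub (μ := P) hmeas
  rw [measureReal_def, hP, ENNReal.toReal_ofReal (Real.exp_nonneg _)] at h1
  rw [capacityFunctional]
  linarith
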